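/- For classes $\mathfrak X$ of abelian groups let $\mathfrak X^{\perp}$ be the class of all abelian groups $Y$ with $\operatorname{Ext}(X,Y)=0$ for all $X\in\mathfrak X$, and let ${}^{\perp}\mathfrak X$ be the class of all abelian groups $Y$ with $\operatorname{Ext}(Y,X)=0$ for all $X\in\mathfrak X$, where $\operatorname{Ext}=\operatorname{Ext}^1_{\mathbb Z}$. A cotorsion theory is a pair $(\mathfrak F,\mathfrak C)$ of classes of abelian groups with $\mathfrak C=\mathfrak F^{\perp}$ and $\mathfrak F={}^{\perp}\mathfrak C$. The cotorsion theory cogenerated by an abelian group $A$ is $({}^{\perp}(\{A\}^{\perp}),\{A\}^{\perp})$. A cotorsion theory $(\mathfrak F,\mathfrak C)$ has enough injectives if for every abelian group $G$ there is a short exact sequence $0\to G\to C\to F\to 0$ with $C\in\mathfrak C$ and $F\in\mathfrak F$; it has enough projectives if for every abelian group $G$ there is a short exact sequence $0\to C\to F\to G\to 0$ with $C\in\mathfrak C$ and $F\in\mathfrak F$. **Corollary 6.2.** (a) Every rational cotorsion theory, i.e. every cotorsion theory cogenerated by a subgroup of $\mathbb Q$, has enough projectives and enough injectives. (b) The quasi-cotorsion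 theory, i.e. the cotorsion theory cogenerated by $\bigoplus_p\mathbb Z_{(p)}$, and the locally cotorsion theory, i.e. the cotorsion theory cogenerated by $\bigoplus_p\mathbb Q^p$, have enough projectives and enough injectives. Here $p$ runs over all primes, $\mathbb Z_{(p)}$ is the group of rational numbers that can be written with a denominator prime to $p$, and $\mathbb Q^p=\{z/p^n : z\in\mathbb Z,\ n\in\mathbb Z_{\ge 0}\}$. -/

import Mathlib

open CategoryTheory

universe u

namespace AbCotorsion

/-- `𝒳^⊥`: the class of all abelian groups `Y` with `Ext(X, Y) = 0` for all `X` in `𝒳`.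
Here `Ext` is `Ext¹` in the category of abelian groups. -/
def rightPerp (𝒳 : ObjectProperty AddCommGrpCat.{u}) : ObjectProperty AddCommGrpCat.{u} :=
  fun Y => ∀ X : AddCommGrpCat.{u}, 𝒳 X → Subsingleton (Abelian.Ext X Y 1)

/-- `^⊥𝒴`: the class of all abelian groups `X` with `Ext(X, Y) = 0` for all `Y` in `𝒴`. -/
def leftPerp (𝒴 : ObjectProperty AddCommGrpCat.{u}) : ObjectProperty AddCommGrpCat.{u} :=
  fun X => ∀ Y : AddCommGrpCat.{u}, 𝒴 Y → Subsingleton (Abelian.Ext X Y 1)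

theorem rightPerp_leftPerp_rightPerp (𝒳 : ObjectProperty AddCommGrpCat.{u}) :
    rightPerp (leftPerp (rightPerp 𝒳)) = rightPerp 𝒳 := by
  ext Y
  exact ⟨fun h X hX => h X fun _ hZ => hZ X hX, fun h _ hX => hX Y h⟩

end AbCotorsion

open AbCotorsion

/-- A cotorsion theory of abelian groups: a pair of classes each of which is the largest one
that is `Ext`-orthogonal to the other. -/
@[ext]
structure CotorsionTheory where
  /-- the torsion-free class `𝔉` -/
  torsionFree : ObjectProperty AddCommGrpCat.{u}
  /-- the cotorsion class `ℭ` -/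
  cotorsion : ObjectProperty AddCommGrpCat.{u}
  cotorsion_eq : cotorsion = rightPerp torsionFree
  torsionFree_eq : torsionFree = leftPerp cotorsion

namespace CotorsionTheory

/-- The cotorsion theory `(^⊥(𝒳^⊥), 𝒳^⊥)` cogenerated by the class `𝒳`. -/
def cogeneratedBy (𝒳 : ObjectProperty AddCommGrpCat.{u}) : CotorsionTheory.{u} where
  torsionFree := leftPerp (rightPerp 𝒳)
  cotorsion := rightPerp 𝒳
  cotorsion_eq := (rightPerp_leftPerp_rightPerp 𝒳).symm
  torsionFree_eq := rfl

/-- The cotorsion theory cogenerated by a single abelian group `A`. The group is lifted to the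
universe `u` in which the groups of the cotorsion theory live. -/
def cogeneratedByGroup (A : Type) [AddCommGroup A] : CotorsionTheory.{u} :=
  cogeneratedBy fun X => X = AddCommGrpCat.of (ULift.{u} A)

/-- A cotorsion theory is rational if it is cogenerated by a subgroup of `ℚ`. -/
def IsRational (T : CotorsionTheory.{u}) : Prop :=
  ∃ S : AddSubgroup ℚ, T = cogeneratedByGroup S

/-- Enough injectives: each abelian group `G` has a short exact sequence `0 → G → C → F → 0`
with `C` in the cotorsion class and `F` in the torsion-free class. -/
def HasEnoughInjectives (T : CotorsionTheory.{u}) : Prop :=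
  ∀ G : AddCommGrpCat.{u}, ∃ (C F : AddCommGrpCat.{u}) (f : G ⟶ C) (g : C ⟶ F) (w : f ≫ g = 0),
    T.cotorsion C ∧ T.torsionFree F ∧ (ShortComplex.mk f g w).ShortExact

/-- Enough projectives: each abelian group `G` has a short exact sequence `0 → C → F → G → 0`
with `C` in the cotorsion class and `F` in the torsion-free class. -/
def HasEnoughProjectives (T : CotorsionTheory.{u}) : Prop :=
  ∀ G : AddCommGrpCat.{u}, ∃ (C F : AddCommGrpCat.{u}) (f : C ⟶ F) (g : F ⟶ G) (w : f ≫ g = 0),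
    T.cotorsion C ∧ T.torsionFree F ∧ (ShortComplex.mk f g w).ShortExact

end CotorsionTheory

namespace AbCotorsion

/-- `ℤ_(p)`: the subgroup of `ℚ` of all fractions whose denominator is prime to `p`. -/
def localizedAt (p : Nat.Primes) : AddSubgroup ℚ where
  carrier := {q | ∃ a b : ℤ, ¬ ((p : ℕ) : ℤ) ∣ b ∧ q = a / b}
  zero_mem' := ⟨0, 1, by
    have := p.2.one_lt
    exact fun h => absurd (Int.le_of_dvd one_pos h) (by omega), by simp⟩
  add_mem' := by
    rintro _ _ ⟨a, b, hb, rfl⟩ ⟨c, d, hd, rfl⟩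
    have hp : Prime ((p : ℕ) : ℤ) := Nat.prime_iff_prime_int.mp p.2
    have hb0 : (b : ℚ) ≠ 0 := by
      rintro h
      exact hb (by simp [Int.cast_eq_zero.mp h])
    have hd0 : (d : ℚ) ≠ 0 := by
      rintro h
      exact hd (by simp [Int.cast_eq_zero.mp h])
    refine ⟨a * d + b * c, b * d, fun h => (hp.dvd_or_dvd h).elim hb hd, ?_⟩
    push_cast
    rw [div_add_div _ _ hb0 hd0]
  neg_mem' := by
    rintro _ ⟨a, b, hb, rfl⟩
    exact ⟨-a, b, hb, by push_cast; ring⟩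

/-- `ℚ^p = ℤ[1/p]`: the subgroup of `ℚ` of all fractions `z / p ^ n`. -/
def localizedAway (p : Nat.Primes) : AddSubgroup ℚ where
  carrier := {q | ∃ (z : ℤ) (n : ℕ), q = z / ((p : ℕ) : ℚ) ^ n}
  zero_mem' := ⟨0, 0, by simp⟩
  add_mem' := by
    rintro _ _ ⟨a, m, rfl⟩ ⟨b, n, rfl⟩
    have hp : ((p : ℕ) : ℚ) ≠ 0 := Nat.cast_ne_zero.mpr p.2.ne_zero
    refine ⟨a * (p : ℕ) ^ n + (p : ℕ) ^ m * b, m + n, ?_⟩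
    push_cast
    rw [div_add_div _ _ (pow_ne_zero _ hp) (pow_ne_zero _ hp), pow_add]
  neg_mem' := by
    rintro _ ⟨a, n, rfl⟩
    exact ⟨-a, n, by push_cast; ring⟩

end AbCotorsion

namespace CotorsionTheory

/-- The quasi-cotorsion theory: its cotorsion class consists of the groups `G` with
`Ext(⨁ₚ ℤ_(p), G) = 0`. -/
noncomputable def quasiCotorsion : CotorsionTheory.{u} :=
  cogeneratedByGroup (DirectSum Nat.Primes fun p => localizedAt p)

/-- The locally cotorsion theory: its cotorsion class consists of the groups `G` with
`Ext(⨁ₚ ℚ^p, G) = 0`. -/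
noncomputable def locallyCotorsion : CotorsionTheory.{u} :=
  cogeneratedByGroup (DirectSum Nat.Primes fun p => localizedAway p)

end CotorsionTheory

/-!
Every cotorsion theory cogenerated by a single abelian group `A` has enough projectives and
enough injectives (Eklof–Trlifaj); nothing special about subgroups of `ℚ` is needed. The proof
is the small object argument in a Grothendieck abelian category with enough projectives.

Let `J` consist of the inclusion `K ⟶ P` of a projective presentation `0 ⟶ K ⟶ P ⟶ A ⟶ 0` and
of `0 ⟶ Q` for a projective separator `Q` (`presentations`). Both are monomorphisms, so the
small object argument applies (`hasSmallObjectArgument_ofHoms`): each morphism factors as a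
`J`-cofibration followed by a map with the right lifting property against `J`. Two facts
translate this into `Ext¹`:

* if `p` has the right lifting property against `J`, then `Ext¹(A, ker p) = 0`
  (`subsingleton_ext_of_hasLiftingProperty`), and `p` is epi because of `0 ⟶ Q`;
* if `i` is a `J`-cofibration, then `Ext¹(coker i, Y) = 0` for each `Y` in `A^⊥`
  (`subsingleton_ext_of_llp_rlp`). For such `Y`, an embedding of `Y` into an injective object
  `I` gives a map `I ⟶ I / Y` with the right lifting property against `J`
  (`hasLiftingProperty_of_subsingleton_ext`); hence `i` lifts against it, which says exactly
  that every map `coker i ⟶ I / Y` lifts to `I`. No filtration of `coker i` is inspected.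

Factoring `G ⟶ 0` gives the sequence `0 ⟶ G ⟶ C ⟶ F ⟶ 0`, and factoring `0 ⟶ G` gives
`0 ⟶ C ⟶ F ⟶ G ⟶ 0`.
-/

namespace AbCotorsion

open Limits MorphismProperty Abelian
open scoped ZeroObject

section

universe w w' v u'

variable {𝒜 : Type u'} [Category.{v} 𝒜] [Abelian 𝒜]

/-! ### The small object argument for a small family of monomorphisms -/

/-- A small family of monomorphisms in a Grothendieck abelian category permits the small object
argument: relative cell complexes are chains of monomorphisms, and `Hom(K i, -)` commutes with
the colimits of sufficiently long such chains. -/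
theorem hasSmallObjectArgument_ofHoms [IsGrothendieckAbelian.{w} 𝒜] {ι : Type w}
    {K P : ι → 𝒜} (j : ∀ i, K i ⟶ P i) [∀ i, Mono (j i)] :
    HasSmallObjectArgument.{w} (ofHoms j) := by
  have hj : ofHoms j ≤ monomorphisms 𝒜 := by
    rintro _ _ _ ⟨i⟩
    exact inferInstanceAs (Mono (j i))
  obtain ⟨κ, hκ', hκ⟩ := HasCardinalLT.exists_regular_cardinal.{w} (Σ i, Subobject (K i))
  have : Fact κ.IsRegular := ⟨hκ'⟩
  have : Nonempty κ.ord.ToType := by simpa using hκ'.ne_zero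
  have := WellFoundedLT.toOrderBot κ.ord.ToType
  refine ⟨κ, inferInstance, inferInstance, { preservesColimit := ?_ }⟩
  intro A B X Y i hi f hf
  let hf' : (monomorphisms 𝒜).TransfiniteCompositionOfShape κ.ord.ToType f :=
    { toTransfiniteCompositionOfShape := hf.toTransfiniteCompositionOfShape
      map_mem k hk := by
        have := (hf.attachCells k hk).pushouts_coproducts
        simp only [ofHoms_homFamily] at this
        refine (?_ : _ ≤ monomorphisms 𝒜) _ this
        simp only [pushouts_le_iff, coproducts_le_iff]
        exact hj }
  have (k k' : κ.ord.ToType) (φ : k ⟶ k') : Mono (hf'.F.map φ) := hf'.mem_map φ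
  apply IsGrothendieckAbelian.preservesColimit_coyoneda_obj_of_mono (Y := hf'.F) (κ := κ)
  obtain ⟨i⟩ := hi
  exact hκ.of_injective (fun S : Subobject (K i) => (⟨i, S⟩ : Σ i, Subobject (K i)))
    fun S S' h => by simpa using h

/-! ### Vanishing of `Ext¹` and lifting properties -/

variable [HasExt.{w'} 𝒜]

theorem subsingleton_ext_of_forall_exists_lift {T : ShortComplex 𝒜} (hT : T.ShortExact)
    [Injective T.X₂] {X : 𝒜} (h : ∀ q : X ⟶ T.X₃, ∃ l : X ⟶ T.X₂, l ≫ T.g = q) :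
    Subsingleton (Ext X T.X₁ 1) := by
  refine subsingleton_of_forall_eq 0 fun e => ?_
  obtain ⟨e', rfl⟩ := Ext.covariant_sequence_exact₁ X hT e (Ext.eq_zero_of_injective _) rfl
  obtain ⟨q, rfl⟩ := Ext.mk₀_bijective _ _ |>.2 e'
  obtain ⟨l, rfl⟩ := h q
  rw [← Ext.mk₀_comp_mk₀, Ext.comp_assoc_of_second_deg_zero, hT.comp_extClass, Ext.comp_zero]

theorem exists_lift_of_subsingleton_ext {T : ShortComplex 𝒜} (hT : T.ShortExact) {X : 𝒜}
    [Subsingleton (Ext X T.X₁ 1)] (q : X ⟶ T.X₃) : ∃ l : X ⟶ T.X₂, l ≫ T.g = q := by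
  obtain ⟨e, he⟩ := Ext.covariant_sequence_exact₃ X hT (Ext.mk₀ q) (zero_add 1)
    (Subsingleton.elim _ _)
  obtain ⟨l, rfl⟩ := Ext.mk₀_bijective _ _ |>.2 e
  exact ⟨l, (Ext.mk₀_bijective _ _).1 (by rw [← he, Ext.mk₀_comp_mk₀])⟩

theorem subsingleton_ext_of_forall_exists_extension {S : ShortComplex 𝒜} (hS : S.ShortExact)
    [Projective S.X₂] {Y : 𝒜} (h : ∀ q : S.X₁ ⟶ Y, ∃ l : S.X₂ ⟶ Y, S.f ≫ l = q) :
    Subsingleton (Ext S.X₃ Y 1) := by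
  refine subsingleton_of_forall_eq 0 fun e => ?_
  obtain ⟨e', rfl⟩ := Ext.contravariant_sequence_exact₃ hS Y e (Ext.eq_zero_of_projective _)
    (add_zero 1)
  obtain ⟨q, rfl⟩ := Ext.mk₀_bijective _ _ |>.2 e'
  obtain ⟨l, rfl⟩ := h q
  rw [← Ext.mk₀_comp_mk₀, hS.extClass_comp_assoc]

/-- If `Ext¹(A, Y) = 0`, then any monomorphism with cokernel `A` has the left lifting property
against any epimorphism with kernel `Y` whose source is injective. -/
theorem hasLiftingProperty_of_subsingleton_ext {S T : ShortComplex 𝒜} (hS : S.ShortExact)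
    (hT : T.ShortExact) [Injective T.X₂] [Subsingleton (Ext S.X₃ T.X₁ 1)] :
    HasLiftingProperty S.f T.g := by
  have := hS.mono_f
  have := hS.epi_g
  refine ⟨fun {t b} sq => ?_⟩
  -- `t` extends to `S.X₂`, and the error made in the lower triangle factors through `S.X₃`.
  let t' : S.X₂ ⟶ T.X₂ := Injective.factorThru t S.f
  have ht' : S.f ≫ t' = t := Injective.comp_factorThru t S.f
  have hd : S.f ≫ (b - t' ≫ T.g) = 0 := by
    rw [Preadditive.comp_sub, reassoc_of% ht', sq.w, sub_self]
  obtain ⟨l, hl⟩ := exists_lift_of_subsingleton_ext hT (hS.exact.desc _ hd)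
  refine ⟨⟨⟨t' + S.g ≫ l, ?_, ?_⟩⟩⟩
  · simp [ht']
  · rw [Preadditive.add_comp, Category.assoc, hl, hS.exact.g_desc, add_sub_cancel]

/-- Kernels of maps that lift against a projective presentation of `A` lie in `A^⊥`. -/
theorem subsingleton_ext_of_hasLiftingProperty {S : ShortComplex 𝒜} (hS : S.ShortExact)
    [Projective S.X₂] {T : ShortComplex 𝒜} (hT : T.Exact) [Mono T.f]
    [HasLiftingProperty S.f T.g] : Subsingleton (Ext S.X₃ T.X₁ 1) := by
  refine subsingleton_ext_of_forall_exists_extension hS fun q => ?_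
  have sq : CommSq (q ≫ T.f) S.f T.g 0 := ⟨by simp⟩
  refine ⟨hT.lift sq.lift sq.fac_right, ?_⟩
  rw [← cancel_mono T.f, Category.assoc, hT.lift_f, sq.fac_left]

/-! ### Approximation sequences -/

section Approximation

variable {ι : Type w} {S : ι → ShortComplex 𝒜} (hS : ∀ i, (S i).ShortExact)

include hS

/-- If `T.f` is a cofibration for the family of monomorphisms `(S i).f`, then its cokernel is left
orthogonal to every object that is right orthogonal to all `(S i).X₃`. -/
theorem subsingleton_ext_of_llp_rlp [EnoughInjectives 𝒜] {T : ShortComplex 𝒜} (hT : T.Exact)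
    [Epi T.g] (h : (ofHoms fun i => (S i).f).rlp.llp T.f) {Y : 𝒜}
    (hY : ∀ i, Subsingleton (Ext (S i).X₃ Y 1)) : Subsingleton (Ext T.X₃ Y 1) := by
  let R := ShortComplex.mk _ _ (cokernel.condition (Injective.ι Y))
  have hR : R.ShortExact :=
    { exact := ShortComplex.exact_of_g_is_cokernel _ (cokernelIsCokernel R.f) }
  have : Injective R.X₂ := inferInstanceAs (Injective (Injective.under Y))
  refine subsingleton_ext_of_forall_exists_lift (T := R) hR fun q => ?_
  have hlift : HasLiftingProperty T.f R.g := by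
    refine h _ ?_
    rintro _ _ _ ⟨i⟩
    have : Subsingleton (Ext (S i).X₃ R.X₁ 1) := hY i
    exact hasLiftingProperty_of_subsingleton_ext (hS i) hR
  have sq : CommSq (0 : T.X₁ ⟶ R.X₂) T.f R.g (T.g ≫ q) := ⟨by simp⟩
  refine ⟨hT.desc sq.lift sq.fac_left, ?_⟩
  rw [← cancel_epi T.g, hT.g_desc_assoc, sq.fac_right]

variable [IsGrothendieckAbelian.{w} 𝒜] [∀ i, Projective (S i).X₂]

/-- Special preenvelopes, obtained by factoring `G ⟶ 0`. -/
theorem exists_shortExact_specialPreenvelope [EnoughInjectives 𝒜] (G : 𝒜) :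
    ∃ (C F : 𝒜) (f : G ⟶ C) (g : C ⟶ F) (w : f ≫ g = 0),
      (∀ i, Subsingleton (Ext (S i).X₃ C 1)) ∧
      (∀ Y, (∀ i, Subsingleton (Ext (S i).X₃ Y 1)) → Subsingleton (Ext F Y 1)) ∧
      (ShortComplex.mk f g w).ShortExact := by
  have := fun i => (hS i).mono_f
  have := hasSmallObjectArgument_ofHoms fun i => (S i).f
  let d := factorizationData (ofHoms fun i => (S i).f).rlp.llp (ofHoms fun i => (S i).f).rlp
    (0 : G ⟶ 0)
  let T := ShortComplex.mk d.i (cokernel.π d.i) (cokernel.condition _)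
  have hT : T.Exact := ShortComplex.exact_of_g_is_cokernel _ (cokernelIsCokernel _)
  -- `G` embeds into an injective object, and that embedding factors through `d.i`.
  have : Mono T.f := by
    have hl : HasLiftingProperty d.i (0 : Injective.under G ⟶ 0) := by
      refine d.hi _ ?_
      rintro _ _ _ ⟨i⟩
      refine ⟨fun {t b} sq => ⟨⟨⟨Injective.factorThru t (S i).f, ?_, ?_⟩⟩⟩⟩
      · simp
      · exact (isZero_zero 𝒜).eq_of_tgt _ _
    have sq : CommSq (Injective.ι G) d.i (0 : Injective.under G ⟶ 0) 0 := ⟨by simp⟩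
    have : Mono (d.i ≫ sq.lift) := by
      rw [sq.fac_left]
      infer_instance
    exact mono_of_mono d.i sq.lift
  refine ⟨_, _, _, _, T.zero, fun i => ?_, fun Y hY => subsingleton_ext_of_llp_rlp hS hT d.hi hY,
    { exact := hT }⟩
  -- `C` is the kernel of the second factor `C ⟶ 0`.
  let R := ShortComplex.mk (𝟙 d.Z) d.p ((isZero_zero 𝒜).eq_of_tgt _ _)
  have hR : R.Exact := (ShortComplex.exact_iff_epi _ ((isZero_zero 𝒜).eq_of_tgt _ _)).2
    (inferInstanceAs (Epi (𝟙 d.Z)))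
  have : Mono R.f := inferInstanceAs (Mono (𝟙 d.Z))
  have : HasLiftingProperty (S i).f R.g := d.hp _ ⟨i⟩
  exact subsingleton_ext_of_hasLiftingProperty (hS i) hR

/-- Special precovers, obtained by factoring `0 ⟶ G`. The map `0 ⟶ (S i₀).X₂` in the family makes
the second factor an epimorphism. -/
theorem exists_shortExact_specialPrecover [EnoughInjectives 𝒜] {i₀ : ι} (h₀ : IsZero (S i₀).X₁)
    (hsep : IsSeparator (S i₀).X₂) (G : 𝒜) :
    ∃ (C F : 𝒜) (f : C ⟶ F) (g : F ⟶ G) (w : f ≫ g = 0),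
      (∀ i, Subsingleton (Ext (S i).X₃ C 1)) ∧
      (∀ Y, (∀ i, Subsingleton (Ext (S i).X₃ Y 1)) → Subsingleton (Ext F Y 1)) ∧
      (ShortComplex.mk f g w).ShortExact := by
  have := fun i => (hS i).mono_f
  have := hasSmallObjectArgument_ofHoms fun i => (S i).f
  let d := factorizationData (ofHoms fun i => (S i).f).rlp.llp (ofHoms fun i => (S i).f).rlp
    (0 : 0 ⟶ G)
  let T := ShortComplex.mk (kernel.ι d.p) d.p (kernel.condition _)
  have hT : T.Exact := ShortComplex.exact_of_f_is_kernel _ (kernelIsKernel _)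
  have : Mono T.f := inferInstanceAs (Mono (kernel.ι d.p))
  have hl (i : ι) : HasLiftingProperty (S i).f d.p := d.hp _ ⟨i⟩
  -- Lifting against `0 ⟶ (S i₀).X₂` for the separator `(S i₀).X₂` forces `d.p` to be epi.
  have : Epi T.g := by
    refine Preadditive.epi_of_cancel_zero _ fun {Z} q hq => ?_
    refine (Preadditive.isSeparator_iff _).1 hsep q fun a => ?_
    have := hl i₀
    have sq : CommSq (0 : (S i₀).X₁ ⟶ d.Z) (S i₀).f d.p a := ⟨h₀.eq_of_src _ _⟩
    rw [← sq.fac_right, Category.assoc, show d.p ≫ q = 0 from hq, comp_zero]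
  refine ⟨_, _, _, _, T.zero, fun i => ?_, fun Y hY => ?_, { exact := hT }⟩
  · have := hl i
    exact subsingleton_ext_of_hasLiftingProperty (T := T) (hS i) hT
  · let R := ShortComplex.mk d.i (𝟙 d.Z) ((isZero_zero 𝒜).eq_of_src _ _)
    have hR : R.Exact := (ShortComplex.exact_iff_mono _ ((isZero_zero 𝒜).eq_of_src _ _)).2
      (inferInstanceAs (Mono (𝟙 d.Z)))
    have : Epi R.g := inferInstanceAs (Epi (𝟙 d.Z))
    exact subsingleton_ext_of_llp_rlp (T := R) hS hR d.hi hY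

end Approximation

end

/-! ### Cotorsion theories cogenerated by one group -/

instance : EnoughProjectives AddCommGrpCat.{u} :=
  (forget₂ (ModuleCat.{u} ℤ) AddCommGrpCat.{u}).asEquivalence.enoughProjectives_iff.1 inferInstance

/-- At `some _`, a projective presentation of `A`; at `none`, the presentation `0 ⟶ Q ⟶ Q` of a
projective separator `Q`, which leaves the right orthogonal class unchanged. -/
noncomputable def presentations (A : AddCommGrpCat.{u}) :
    Option PUnit.{u + 1} → ShortComplex AddCommGrpCat.{u}
  | none => ShortComplex.mk (0 : 0 ⟶ Projective.over (separator AddCommGrpCat.{u})) (𝟙 _)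
      zero_comp
  | some _ => ShortComplex.mk _ _ (kernel.condition (Projective.π A))

theorem presentations_shortExact (A : AddCommGrpCat.{u}) :
    ∀ i, (presentations A i).ShortExact
  | none =>
    { exact := (ShortComplex.exact_iff_mono _ rfl).2
        (inferInstanceAs (Mono (𝟙 (Projective.over (separator AddCommGrpCat.{u})))))
      mono_f := inferInstanceAs
        (Mono (0 : 0 ⟶ Projective.over (separator AddCommGrpCat.{u})))
      epi_g := inferInstanceAs (Epi (𝟙 (Projective.over (separator AddCommGrpCat.{u})))) }
  | some _ =>
    { exact := ShortComplex.exact_of_f_is_kernel _ (kernelIsKernel _)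
      mono_f := inferInstanceAs (Mono (kernel.ι (Projective.π A)))
      epi_g := inferInstanceAs (Epi (Projective.π A)) }

instance presentations_projective (A : AddCommGrpCat.{u}) :
    ∀ i, Projective (presentations A i).X₂
  | none => inferInstanceAs (Projective (Projective.over _))
  | some _ => inferInstanceAs (Projective (Projective.over _))

theorem isSeparator_presentations_none (A : AddCommGrpCat.{u}) :
    IsSeparator (presentations A none).X₂ := by
  refine (Preadditive.isSeparator_iff _).2 fun X Y f hf => ?_
  refine (Preadditive.isSeparator_iff _).1 (isSeparator_separator AddCommGrpCat.{u}) f fun a => ?_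
  rw [← cancel_epi (Projective.π _), comp_zero, ← Category.assoc]
  exact hf _

theorem rightPerp_iff_presentations {A Y : AddCommGrpCat.{u}} :
    rightPerp (fun X => X = A) Y ↔ ∀ i, Subsingleton (Ext (presentations A i).X₃ Y 1) := by
  refine ⟨fun h i => ?_, fun h X hX => hX ▸ h (some ⟨⟩)⟩
  cases i with
  | none =>
    have : Projective (presentations A none).X₃ := presentations_projective A none
    exact Ext.subsingleton_of_projective _ _ 0
  | some _ => exact h A rfl

theorem hasEnoughInjectives_cogeneratedBy_singleton (A : AddCommGrpCat.{u}) :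
    (CotorsionTheory.cogeneratedBy fun X => X = A).HasEnoughInjectives := by
  intro G
  obtain ⟨C, F, f, g, w, hC, hF, h⟩ :=
    exists_shortExact_specialPreenvelope (presentations_shortExact A) G
  exact ⟨C, F, f, g, w, rightPerp_iff_presentations.2 hC,
    fun Y hY => hF Y (rightPerp_iff_presentations.1 hY), h⟩

theorem hasEnoughProjectives_cogeneratedBy_singleton (A : AddCommGrpCat.{u}) :
    (CotorsionTheory.cogeneratedBy fun X => X = A).HasEnoughProjectives := by
  intro G
  obtain ⟨C, F, f, g, w, hC, hF, h⟩ :=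
    exists_shortExact_specialPrecover (presentations_shortExact A) (i₀ := none)
      (isZero_zero AddCommGrpCat.{u}) (isSeparator_presentations_none A) G
  exact ⟨C, F, f, g, w, rightPerp_iff_presentations.2 hC,
    fun Y hY => hF Y (rightPerp_iff_presentations.1 hY), h⟩

end AbCotorsion
theorem corollary6p2 :
    (∀ T : CotorsionTheory.{u}, T.IsRational → T.HasEnoughProjectives ∧ T.HasEnoughInjectives) ∧
    (CotorsionTheory.quasiCotorsion.{u}.HasEnoughProjectives ∧
      CotorsionTheory.quasiCotorsion.{u}.HasEnoughInjectives) ∧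
    (CotorsionTheory.locallyCotorsion.{u}.HasEnoughProjectives ∧
      CotorsionTheory.locallyCotorsion.{u}.HasEnoughInjectives) := by
  refine ⟨?_, ⟨?_, ?_⟩, ?_, ?_⟩
  · rintro T ⟨A, rfl⟩
    exact ⟨hasEnoughProjectives_cogeneratedBy_singleton _,
      hasEnoughInjectives_cogeneratedBy_singleton _⟩
  · exact hasEnoughProjectives_cogeneratedBy_singleton _
  · exact hasEnoughInjectives_cogeneratedBy_singleton _
  · exact hasEnoughProjectives_cogeneratedBy_singleton _
  · exact hasEnoughInjectives_cogeneratedBy_singleton _
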